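/- Let $\mathfrak R$ be a complete, separated topological associative unital ring in which open right ideals form a base of neighborhoods of zero. For a set $X$, let $\mathfrak R[[X]]$ denote the set of all formal linear combinations $\sum_{x\in X}r_xx$ whose coefficients $r_x\in\mathfrak R$ converge to zero, i.e. for every open right ideal $\mathfrak I\subset\mathfrak R$ one has $r_x\in\mathfrak I$ for all but finitely many $x\in X$. The functor $X\mapsto\mathfrak R[[X]]$ is a monad on the category of sets, with the unit $x\mapsto 1\cdot x$ and the multiplication $\mathfrak R[[\mathfrak R[[X]]]]\to\mathfrak R[[X]]$ given by opening parentheses. Left $\mathfrak R$-contramodules are the algebras over this monad; they form an abelian category $\mathfrak R\text{-}\mathrm{contra}$ with enough projective objects. A right $\mathfrak R$-module $\mathcal N$ is discrete if the annihilator of each of its elements is open in $\mathfrak R$. For a discrete right $\mathfrak R$-module $\mathcal N$ and a left $\mathfrak R$-contramodule $\mathfrak C$ with the contraaction map $\pi\colon\mathfrak R[[\mathfrak C]]\to\mathfrak C$, the contratensor product $\mathcal N\odot_{\mathfrak R}\mathfrak C$ is the quotient group of $\mathcal N\otimes_{\mathbb Z}\mathfrak C$ by the subgroup generated by all elements $b\otimes\pi\bigl(\sum_{c}r_cc\bigr)-\sum_{c}br_c\otimes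 c$ with $b\in\mathcal N$ and $\sum_{c}r_cc\in\mathfrak R[[\mathfrak C]]$. Let $\mathrm{Ctrtor}_i^{\mathfrak R}(\mathcal N,-)$, $i\ge0$, be the left derived functors of $\mathcal N\odot_{\mathfrak R}-\colon\mathfrak R\text{-}\mathrm{contra}\to\mathbb Z\text{-}\mathrm{mod}$. A left $\mathfrak R$-contramodule $\mathfrak F$ is $\infty$-strictly flat if $\mathrm{Ctrtor}_i^{\mathfrak R}(\mathcal N,\mathfrak F)=0$ for all discrete right $\mathfrak R$-modules $\mathcal N$ and all $i\ge1$. (a) Let $J$ be a nonempty countable directed preordered set and let $(\mathfrak P_j)_{j\in J}$ be a $J$-indexed direct system of projective left $\mathfrak R$-contramodules. Then the direct limit $\varinjlim_{j\in J}\mathfrak P_j$ in $\mathfrak R\text{-}\mathrm{contra}$ exists, has projective dimension at most $1$ in $\mathfrak R\text{-}\mathrm{contra}$, and is $\infty$-strictly flat. (b) In particular, for any sequence of elements $a_1,a_2,a_3,\ldots$ of $\mathfrak R$, the Bass flat left $\mathfrak R$-contramodule $$\mathfrak B=\varinjlim\bigl(\mathfrak R\xrightarrow{*a_1}\mathfrak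 R\xrightarrow{*a_2}\mathfrak R\xrightarrow{*a_3}\cdots\bigr),$$ where $\mathfrak R$ is viewed as the free left $\mathfrak R$-contramodule with one generator and $*a_n$ is right multiplication by $a_n$, exists, has projective dimension at most $1$ in $\mathfrak R\text{-}\mathrm{contra}$, and is $\infty$-strictly flat. -/

import Mathlib

open CategoryTheory CategoryTheory.Limits Filter Topology

universe u w

set_option linter.unusedSectionVars false

namespace Contra

noncomputable section

variable {R : Type u} [Ring R] [UniformSpace R]

/-- The group `R[[X]]` of infinite formal linear combinations `∑ r_x x` of elements of `X`, with
the coefficients `r_x` converging to zero in the topology of `R`. -/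
def convComb (R : Type u) [Ring R] [UniformSpace R] [IsUniformAddGroup R] (X : Type*) :
    AddSubgroup (X → R) where
  carrier := {r | Tendsto r cofinite (𝓝 0)}
  zero_mem' := tendsto_const_nhds
  add_mem' ha hb := by simpa only [add_zero] using! Tendsto.add ha hb
  neg_mem' ha := by simpa only [neg_zero] using! Tendsto.neg ha

variable [IsUniformAddGroup R]

/-- The point measure `1 · x`. -/
def point {X : Type*} (x : X) : convComb R X := by
  classical
  exact ⟨Pi.single x 1, tendsto_const_nhds.congr' (by
    have : ({x}ᶜ : Set X) ∈ cofinite := by simp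
    filter_upwards [this] with y hy
    simp only [Set.mem_compl_iff, Set.mem_singleton_iff] at hy
    simp [hy])⟩

theorem point_self {X : Type*} (x : X) : (point x : convComb R X).1 x = 1 := by simp [point]

theorem point_ne {X : Type*} {x y : X} (h : y ≠ x) : (point x : convComb R X).1 y = 0 := by
  simp [point, h]

variable [IsTopologicalRing R] [IsLinearTopology Rᵐᵒᵖ R] [CompleteSpace R]

instance (priority := 100) nonarchimedean : NonarchimedeanAddGroup R where
  is_nonarchimedean U hU := by
    obtain ⟨I, hI, hIU⟩ := (IsLinearTopology.hasBasis_open_submodule (M := R) Rᵐᵒᵖ).mem_iff.1 hU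
    exact ⟨⟨I.toAddSubgroup, hI⟩, hIU⟩

theorem summable_of_tendsto {X : Type*} {r : X → R} (h : Tendsto r cofinite (𝓝 0)) :
    Summable r := NonarchimedeanAddGroup.summable_of_tendsto_cofinite_zero h

theorem tendsto_mul_right {X : Type*} {r : X → R} (h : Tendsto r cofinite (𝓝 0)) (t : X → R) :
    Tendsto (fun x => r x * t x) cofinite (𝓝 0) :=
  IsLinearTopology.tendsto_smul_zero (R := Rᵐᵒᵖ) (fun x => MulOpposite.op (t x)) r h

theorem tendsto_mul_prod {X Y : Type*} (r : convComb R Y) (s : Y → convComb R X) :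
    Tendsto (fun p : Y × X => r.1 p.1 * (s p.1).1 p.2) cofinite (𝓝 0) := by
  rw [(IsLinearTopology.hasBasis_open_submodule (M := R) Rᵐᵒᵖ).tendsto_right_iff]
  intro I hI
  have hI0 : (I : Set R) ∈ 𝓝 (0 : R) := hI.mem_nhds I.zero_mem
  have h1 : {y | ¬ r.1 y ∈ I}.Finite := r.2 hI0
  have h2 : ∀ y, {x | ¬ r.1 y * (s y).1 x ∈ I}.Finite := fun y => by
    have : Tendsto (fun x => r.1 y * (s y).1 x) cofinite (𝓝 0) := by
      simpa using Tendsto.const_mul (r.1 y) (s y).2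
    exact this hI0
  refine ((h1.biUnion fun y _ => (h2 y).image (Prod.mk y)).subset ?_)
  rintro ⟨y, x⟩ hp
  have hp : ¬ r.1 y * (s y).1 x ∈ I := hp
  have hy : ¬ r.1 y ∈ I := fun h => hp (I.smul_mem (MulOpposite.op ((s y).1 x)) h)
  simp only [Set.mem_iUnion]
  exact ⟨y, hy, x, hp, rfl⟩

variable [T2Space R]

/-- Substitution: `∑ r_y y` and `y ↦ ∑ s_{y,x} x` are sent to `∑_x (∑_y r_y s_{y,x}) x`. -/
def bind {X Y : Type*} (r : convComb R Y) (s : Y → convComb R X) : convComb R X :=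
  ⟨fun x => ∑' y, r.1 y * (s y).1 x, by
    have h := (summable_of_tendsto (tendsto_mul_prod r s)).prod_symm
    exact h.prod.tendsto_cofinite_zero⟩

theorem bind_bind {X Y Z : Type*} (r : convComb R Z) (s : Z → convComb R Y)
    (t : Y → convComb R X) : bind (bind r s) t = bind r fun z => bind (s z) t := by
  ext x
  have h := summable_of_tendsto
    (tendsto_mul_right (tendsto_mul_prod r s) fun p => (t p.2).1 x)
  have h1 : ∀ y, Summable fun z => r.1 z * (s z).1 y := fun y =>
    (summable_of_tendsto (tendsto_mul_prod r s)).prod_symm.prod_factor y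
  have h2 : ∀ z, Summable fun y => (s z).1 y * (t y).1 x := fun z =>
    summable_of_tendsto (tendsto_mul_right (s z).2 _)
  change ∑' y, (∑' z, r.1 z * (s z).1 y) * (t y).1 x =
    ∑' z, r.1 z * ∑' y, (s z).1 y * (t y).1 x
  simp_rw [← (h1 _).tsum_mul_right, ← (h2 _).tsum_mul_left, ← mul_assoc]
  exact (Summable.tsum_comm (f := fun z y => r.1 z * (s z).1 y * (t y).1 x) h)

theorem bind_point {X : Type*} (r : convComb R X) : bind r point = r := by
  ext x
  change ∑' y, r.1 y * (point y : convComb R X).1 x = r.1 x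
  rw [tsum_eq_single x fun y hy => by rw [point_ne hy.symm, mul_zero], point_self, mul_one]

theorem point_bind {X Y : Type*} (y : Y) (s : Y → convComb R X) : bind (point y) s = s y := by
  ext x
  change ∑' z, (point y : convComb R Y).1 z * (s z).1 x = _
  rw [tsum_eq_single y fun z hz => by rw [point_ne hz, zero_mul], point_self, one_mul]

theorem bind_add {X Y : Type*} (r : convComb R Y) (s t : Y → convComb R X) :
    (bind r fun y => s y + t y) = bind r s + bind r t := by
  ext x
  change ∑' y, r.1 y * ((s y).1 x + (t y).1 x) = _
  simp_rw [mul_add]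
  exact (summable_of_tendsto (tendsto_mul_right r.2 _)).tsum_add
    (summable_of_tendsto (tendsto_mul_right r.2 _))

theorem add_bind {X Y : Type*} (r r' : convComb R Y) (s : Y → convComb R X) :
    bind (r + r') s = bind r s + bind r' s := by
  ext x
  change ∑' y, (r.1 y + r'.1 y) * (s y).1 x = _
  simp_rw [add_mul]
  exact (summable_of_tendsto (tendsto_mul_right r.2 _)).tsum_add
    (summable_of_tendsto (tendsto_mul_right r'.2 _))

/-- `bind r s` as an additive function of `r`. -/
def bindHom {X Y : Type*} (s : Y → convComb R X) : convComb R Y →+ convComb R X :=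
  AddMonoidHom.mk' (fun r => bind r s) fun r r' => add_bind r r' s

/-- The map `R[[f]] : R[[X]] → R[[Y]]`, `∑ r_x x ↦ ∑_y (∑_{f x = y} r_x) y`. -/
def map {X Y : Type*} (f : X → Y) (r : convComb R X) : convComb R Y :=
  ⟨fun y => ∑' x : f ⁻¹' {y}, r.1 x, by
    convert (bind r fun x => point (f x)).2 using 2 with y
    change _ = ∑' x, r.1 x * (point (f x) : convComb R Y).1 y
    rw [tsum_subtype]
    refine tsum_congr fun x => ?_
    by_cases h : f x = y
    · subst h; simp [point_self]
    · rw [point_ne (Ne.symm h)]; simp [h]⟩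

theorem map_eq_bind {X Y : Type*} (f : X → Y) (r : convComb R X) :
    map f r = bind r fun x => point (f x) := by
  ext y
  change ∑' x : f ⁻¹' {y}, r.1 x = ∑' x, r.1 x * (point (f x) : convComb R Y).1 y
  rw [tsum_subtype]
  refine tsum_congr fun x => ?_
  by_cases h : f x = y
  · subst h; simp [point_self]
  · rw [point_ne (Ne.symm h)]; simp [h]

/-- Opening of parentheses `R[[R[[X]]]] → R[[X]]`: the coefficient of the image of `∑ r_y y`
at `x` is `∑_y r_y y_x`. -/
def join {X : Type*} (r : convComb R (convComb R X)) : convComb R X :=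
  ⟨fun x => ∑' y, r.1 y * y.1 x, (bind r id).2⟩

theorem join_eq_bind {X : Type*} (r : convComb R (convComb R X)) : join r = bind r id := rfl

variable (R) in
/-- The monad `X ↦ R[[X]]` on the category of sets. -/
def contraMonad : Monad (Type u) where
  obj X := convComb R X
  map f := TypeCat.ofHom (map f)
  map_id X := by
    refine ConcreteCategory.hom_ext _ _ fun r => ?_
    exact (map_eq_bind _ _).trans (bind_point r)
  map_comp f g := by
    refine ConcreteCategory.hom_ext _ _ fun r => ?_
    change map (g ∘ f) r = map g (map f r)
    simp [map_eq_bind, bind_bind, point_bind]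
  η := { app X := TypeCat.ofHom point
         naturality X Y f := by
          refine ConcreteCategory.hom_ext _ _ fun x => ?_
          change point (f x) = map f (point x)
          simp [map_eq_bind, point_bind] }
  μ := { app X := TypeCat.ofHom join
         naturality X Y f := by
          refine ConcreteCategory.hom_ext _ _ fun r => ?_
          change join (map (map f) r) = map f (join r)
          simp [map_eq_bind, join_eq_bind, bind_bind, point_bind] }
  assoc X := by
    refine ConcreteCategory.hom_ext _ _ fun r => ?_
    change join (map join r) = join (join r)
    simp [map_eq_bind, join_eq_bind, bind_bind, point_bind]
  left_unit X := by
    refine ConcreteCategory.hom_ext _ _ fun r => ?_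
    change join (point r) = r
    simp [join_eq_bind, point_bind]
  right_unit X := by
    refine ConcreteCategory.hom_ext _ _ fun r => ?_
    change join (map point r) = r
    simp [map_eq_bind, join_eq_bind, bind_bind, point_bind]
    exact bind_point r

theorem map_map {X Y Z : Type*} (f : X → Y) (g : Y → Z) (r : convComb R X) :
    map g (map f r) = map (fun x => g (f x)) r := by
  simp [map_eq_bind, bind_bind, point_bind]

theorem map_point {X Y : Type*} (f : X → Y) (x : X) :
    map f (point x : convComb R X) = point (f x) := by
  simp [map_eq_bind, point_bind]

theorem map_bind {X Y Z : Type*} (f : X → Y) (r : convComb R Z) (s : Z → convComb R X) :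
    map f (bind r s) = bind r fun z => map f (s z) := by
  simp [map_eq_bind, bind_bind]

theorem bind_map {X Y Z : Type*} (f : Z → Y) (r : convComb R Z) (s : Y → convComb R X) :
    bind (map f r) s = bind r fun z => s (f z) := by
  simp [map_eq_bind, bind_bind, point_bind]

theorem map_id' {X : Type*} (r : convComb R X) : map (fun x => x) r = r := by
  rw [map_eq_bind]; exact bind_point r

theorem map_hom_eq {X Y : Type*} (f : X → Y) :
    (map f : convComb R X → convComb R Y) = bindHom fun x => point (f x) :=
  funext fun r => map_eq_bind f r

variable (R) in
/-- The category of left contramodules over `R`: algebras over the monad `X ↦ R[[X]]`. -/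
abbrev Contramodule := (contraMonad R).Algebra

/-- The contraaction map `R[[C]] → C`. -/
def act (C : Contramodule R) (r : convComb R C.A) : C.A := C.a r

theorem act_point (C : Contramodule R) (c : C.A) : act C (point c) = c :=
  ConcreteCategory.congr_hom C.unit c

theorem act_join (C : Contramodule R) (r : convComb R (convComb R C.A)) :
    act C (join r) = act C (map (act C) r) :=
  ConcreteCategory.congr_hom C.assoc r

theorem act_bind (C : Contramodule R) {X : Type u} (r : convComb R X)
    (s : X → convComb R C.A) : act C (bind r s) = act C (map (fun x => act C (s x)) r) := by
  have h := act_join C (map s r)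
  rw [join_eq_bind, bind_map, map_map] at h
  exact h

theorem hom_act {C D : Contramodule R} (f : C ⟶ D) (r : convComb R C.A) :
    f.f (act C r) = act D (map f.f r) :=
  (ConcreteCategory.congr_hom f.h r).symm

/-- A contramodule from a contraunital and contraassociative contraaction map. -/
def mkObj (C : Type u) (π : convComb R C → C) (h1 : ∀ c, π (point c) = c)
    (h2 : ∀ r, π (join r) = π (map π r)) : Contramodule R where
  A := C
  a := TypeCat.ofHom π
  unit := ConcreteCategory.hom_ext _ _ h1
  assoc := ConcreteCategory.hom_ext _ _ h2

/-- A contramodule morphism from a map commuting with the contraactions. -/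
def mkHom {C D : Contramodule R} (f : C.A → D.A)
    (h : ∀ r, f (act C r) = act D (map f r)) : C ⟶ D where
  f := TypeCat.ofHom f
  h := ConcreteCategory.hom_ext _ _ fun r => (h r).symm

theorem hom_ext {C D : Contramodule R} {f g : C ⟶ D} (h : ∀ c, f.f c = g.f c) : f = g :=
  Monad.Algebra.Hom.ext (ConcreteCategory.hom_ext _ _ h)

/-! The underlying abelian group of a contramodule. -/

instance (C : Contramodule R) : Zero C.A := ⟨act C 0⟩
instance (C : Contramodule R) : Add C.A := ⟨fun a b => act C (point a + point b)⟩
instance (C : Contramodule R) : Neg C.A := ⟨fun a => act C (-point a)⟩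
instance (C : Contramodule R) : Sub C.A := ⟨fun a b => act C (point a - point b)⟩
instance (C : Contramodule R) : SMul ℕ C.A := ⟨fun n a => act C (n • point a)⟩
instance (C : Contramodule R) : SMul ℤ C.A := ⟨fun n a => act C (n • point a)⟩

theorem act_map_act (C : Contramodule R) (t : convComb R (convComb R C.A)) :
    act C (bindHom (fun y => point (act C y)) t) = act C (bindHom id t) := by
  rw [← map_hom_eq, ← act_join]; rfl

theorem bindHom_point {X Y : Type*} (y : Y) (s : Y → convComb R X) :
    bindHom s (point y) = s y := point_bind y s

theorem act_add (C : Contramodule R) (r s : convComb R C.A) :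
    act C (r + s) = act C r + act C s := by
  have := act_map_act C (point r + point s)
  simpa only [map_add, bindHom_point] using! this.symm

theorem act_neg (C : Contramodule R) (r : convComb R C.A) : act C (-r) = -act C r := by
  have := act_map_act C (-point r)
  simpa only [map_neg, bindHom_point] using! this.symm

theorem act_sub (C : Contramodule R) (r s : convComb R C.A) :
    act C (r - s) = act C r - act C s := by
  have := act_map_act C (point r - point s)
  simpa only [map_sub, bindHom_point] using! this.symm

theorem act_nsmul (C : Contramodule R) (r : convComb R C.A) (n : ℕ) :
    act C (n • r) = n • act C r := by
  have := act_map_act C (n • point r)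
  simpa only [map_nsmul, bindHom_point] using! this.symm

theorem act_zsmul (C : Contramodule R) (r : convComb R C.A) (n : ℤ) :
    act C (n • r) = n • act C r := by
  have := act_map_act C (n • point r)
  simpa only [map_zsmul, bindHom_point] using! this.symm

theorem act_surjective (C : Contramodule R) : Function.Surjective (act C) :=
  fun c => ⟨point c, act_point C c⟩

instance (C : Contramodule R) : AddCommGroup C.A :=
  (act_surjective C).addCommGroup (act C) rfl (act_add C) (act_neg C) (act_sub C)
    (act_nsmul C) (act_zsmul C)

theorem act_zero (C : Contramodule R) : act C 0 = 0 := rfl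

theorem add_def (C : Contramodule R) (a b : C.A) : a + b = act C (point a + point b) := rfl

theorem act_map_add (C : Contramodule R) {X : Type u} (f g : X → C.A) (r : convComb R X) :
    act C (map (fun x => f x + g x) r) = act C (map f r) + act C (map g r) := by
  have h : act C (map (fun x => f x + g x) r) = act C (bind r fun x => point (f x) + point (g x)) :=
    (act_bind C r fun x => point (f x) + point (g x)).symm
  rw [h, bind_add, act_add, ← map_eq_bind, ← map_eq_bind]

theorem act_map_zero (C : Contramodule R) {X : Type u} (r : convComb R X) :
    act C (map (fun _ => (0 : C.A)) r) = 0 := by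
  have := act_map_add C (fun _ => (0 : C.A)) (fun _ => (0 : C.A)) r
  simpa using this

theorem act_map_neg (C : Contramodule R) {X : Type u} (f : X → C.A) (r : convComb R X) :
    act C (map (fun x => - f x) r) = - act C (map f r) := by
  have := act_map_add C (fun x => - f x) f r
  simp only [neg_add_cancel, act_map_zero] at this
  exact eq_neg_of_add_eq_zero_left this.symm

/-- The additive map underlying a contramodule morphism. -/
def homAdd {C D : Contramodule R} (f : C ⟶ D) : C.A →+ D.A :=
  AddMonoidHom.mk' (fun c => f.f c) fun a b => by
    change f.f (act C (point a + point b)) = act D (point (f.f a) + point (f.f b))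
    rw [hom_act, map_hom_eq, map_add, bindHom_point, bindHom_point]

theorem f_add {C D : Contramodule R} (f : C ⟶ D) (a b : C.A) : f.f (a + b) = f.f a + f.f b :=
  (homAdd f).map_add a b

instance (C D : Contramodule R) : Zero (C ⟶ D) :=
  ⟨mkHom (fun _ => 0) fun r => (act_map_zero D r).symm⟩
instance (C D : Contramodule R) : Add (C ⟶ D) :=
  ⟨fun f g => mkHom (fun c => f.f c + g.f c) fun r => by
    rw [act_map_add, hom_act, hom_act]⟩
instance (C D : Contramodule R) : Neg (C ⟶ D) :=
  ⟨fun f => mkHom (fun c => -f.f c) fun r => by rw [act_map_neg, hom_act]⟩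

instance (C D : Contramodule R) : AddCommGroup (C ⟶ D) where
  add_assoc f g h := hom_ext fun c => add_assoc (f.f c) (g.f c) (h.f c)
  zero_add f := hom_ext fun c => zero_add (f.f c)
  add_zero f := hom_ext fun c => add_zero (f.f c)
  add_comm f g := hom_ext fun c => add_comm (f.f c) (g.f c)
  neg_add_cancel f := hom_ext fun c => neg_add_cancel (f.f c)
  nsmul := nsmulRec
  zsmul := zsmulRec

instance : Preadditive (Contramodule R) where
  add_comp _ _ _ f f' g := hom_ext fun c => by
    change g.f (f.f c + f'.f c) = g.f (f.f c) + g.f (f'.f c)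
    exact f_add g _ _
  comp_add _ _ _ f g g' := rfl

/-! Cokernels, and the abelian category structure. -/

/-- The image of a contramodule morphism, as a subgroup. -/
def range {C D : Contramodule R} (f : C ⟶ D) : AddSubgroup D.A := (homAdd f).range

theorem act_map_mem_range {C D : Contramodule R} (f : C ⟶ D) {X : Type u} (g : X → D.A)
    (hg : ∀ x, g x ∈ range f) (r : convComb R X) : act D (map g r) ∈ range f := by
  choose h hh using hg
  refine ⟨act C (map h r), ?_⟩
  change f.f (act C (map h r)) = _
  rw [hom_act, map_map]
  congr 2
  exact funext hh

theorem mk_act_eq {C D : Contramodule R} (f : C ⟶ D) {X : Type u} (g g' : X → D.A)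
    (hg : ∀ x, (g x : D.A ⧸ range f) = g' x) (r : convComb R X) :
    (act D (map g r) : D.A ⧸ range f) = act D (map g' r) := by
  rw [QuotientAddGroup.eq, ← act_map_neg, ← act_map_add]
  exact act_map_mem_range f _ (fun x => QuotientAddGroup.eq.1 (hg x)) r

/-- The contraaction on the quotient by the image of a morphism. -/
def quotAct {C D : Contramodule R} (f : C ⟶ D)
    (r : convComb R (D.A ⧸ range f)) : D.A ⧸ range f :=
  (act D (map Quotient.out r) : D.A ⧸ range f)

theorem quotAct_map {C D : Contramodule R} (f : C ⟶ D) {X : Type u} (g : X → D.A)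
    (r : convComb R X) :
    quotAct f (map (fun x => (g x : D.A ⧸ range f)) r) = (act D (map g r) : D.A ⧸ range f) := by
  rw [quotAct, map_map]
  exact mk_act_eq f _ _ (fun x => Quotient.out_eq _) r

/-- The cokernel of a contramodule morphism. -/
def coker {C D : Contramodule R} (f : C ⟶ D) : Contramodule R :=
  mkObj (D.A ⧸ range f) (quotAct f)
    (fun c => by
      rw [quotAct, map_point, act_point]
      exact Quotient.out_eq _)
    fun r => by
      have h := quotAct_map f (fun s => act D (map Quotient.out s)) r
      change quotAct f (map (quotAct f) r) = _ at h
      rw [h, ← act_bind, quotAct, join_eq_bind, map_bind]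
      rfl

/-- The projection onto the cokernel. -/
def cokerπ {C D : Contramodule R} (f : C ⟶ D) : D ⟶ coker f :=
  mkHom (fun d => (d : D.A ⧸ range f)) fun r => by
    have := quotAct_map f (fun x => x) r
    rw [map_id'] at this
    exact this.symm

theorem zero_f {C D : Contramodule R} (c : C.A) : (0 : C ⟶ D).f c = 0 := rfl

theorem cokerπ_eq_zero {C D : Contramodule R} (f : C ⟶ D) (d : D.A) :
    (cokerπ f).f d = 0 ↔ d ∈ range f := by
  have h : (cokerπ f).f d = (cokerπ f).f 0 ↔ d ∈ range f :=
    (QuotientAddGroup.eq (s := range f)).trans (by rw [add_zero, neg_mem_iff])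
  rwa [show (cokerπ f).f 0 = 0 from (homAdd (cokerπ f)).map_zero] at h

theorem comp_cokerπ {C D : Contramodule R} (f : C ⟶ D) : f ≫ cokerπ f = 0 :=
  hom_ext fun c => (cokerπ_eq_zero f _).2 ⟨c, rfl⟩

/-- A morphism descends along a surjective morphism if it is compatible with its fibres. -/
def desc {C D E : Contramodule R} (f : C ⟶ D) (hf : Function.Surjective f.f) (g : C ⟶ E)
    (h : ∀ c, f.f c = 0 → g.f c = 0) : D ⟶ E :=
  have key : ∀ c, g.f (Function.surjInv hf (f.f c)) = g.f c := fun c => by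
    have h1 := h (Function.surjInv hf (f.f c) - c) (by
      have := (homAdd f).map_sub (Function.surjInv hf (f.f c)) c
      refine this.trans (sub_eq_zero.2 (Function.surjInv_eq hf _)))
    have h2 := (homAdd g).map_sub (Function.surjInv hf (f.f c)) c
    exact sub_eq_zero.1 (h2.symm.trans h1)
  mkHom (fun d => g.f (Function.surjInv hf d)) fun r => by
    have h1 : r = map f.f (map (Function.surjInv hf) r) := by
      rw [map_map]; simp only [Function.surjInv_eq, map_id']
    conv_lhs => rw [h1, ← hom_act, key, hom_act, map_map]

theorem comp_desc {C D E : Contramodule R} (f : C ⟶ D) (hf : Function.Surjective f.f)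
    (g : C ⟶ E) (h : ∀ c, f.f c = 0 → g.f c = 0) : f ≫ desc f hf g h = g :=
  hom_ext fun c => by
    have h1 := h (Function.surjInv hf (f.f c) - c) (by
      have := (homAdd f).map_sub (Function.surjInv hf (f.f c)) c
      refine this.trans (sub_eq_zero.2 (Function.surjInv_eq hf _)))
    have h2 := (homAdd g).map_sub (Function.surjInv hf (f.f c)) c
    exact sub_eq_zero.1 (h2.symm.trans h1)

theorem epi_of_surjective {C D : Contramodule R} (f : C ⟶ D) (hf : Function.Surjective f.f) :
    Epi f where
  left_cancellation g h w := hom_ext fun d => by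
    obtain ⟨c, rfl⟩ := hf d
    exact ConcreteCategory.congr_hom (congrArg Monad.Algebra.Hom.f w) c

theorem cokerπ_surjective {C D : Contramodule R} (f : C ⟶ D) :
    Function.Surjective (cokerπ f).f := Quotient.mk_surjective

theorem surjective_of_epi {C D : Contramodule R} (f : C ⟶ D) [Epi f] :
    Function.Surjective f.f := fun d => by
  have h : cokerπ f = 0 := by rw [← cancel_epi f, comp_cokerπ, comp_zero]
  obtain ⟨c, hc⟩ := (cokerπ_eq_zero f d).1 (by rw [h]; rfl)
  exact ⟨c, hc⟩

theorem injective_of_mono {C D : Contramodule R} (f : C ⟶ D) [Mono f] :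
    Function.Injective f.f :=
  (mono_iff_injective _).1 (inferInstanceAs (Mono ((contraMonad R).forget.map f)))

instance : HasCokernels (Contramodule R) where
  has_colimit f := ⟨⟨⟨_, CokernelCofork.IsColimit.ofπ (cokerπ f) (comp_cokerπ f)
    (fun g hg => desc (cokerπ f) (cokerπ_surjective f) g fun d hd => by
      obtain ⟨c, rfl⟩ := (cokerπ_eq_zero f d).1 hd
      exact ConcreteCategory.congr_hom (congrArg Monad.Algebra.Hom.f hg) c)
    (fun g hg => comp_desc _ _ _ _)
    (fun g hg m hm => by
      have := epi_of_surjective _ (cokerπ_surjective f)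
      rw [← cancel_epi (cokerπ f), hm, comp_desc])⟩⟩⟩

instance : HasLimits (Contramodule R) :=
  ⟨fun _ => ⟨fun D => Monad.hasLimit_of_comp_forget_hasLimit D⟩⟩

instance : IsNormalMonoCategory (Contramodule R) where
  normalMonoOfMono {C D} f _ := ⟨⟨coker f, cokerπ f, comp_cokerπ f,
    have hf := injective_of_mono f
    have key : ∀ {W : Contramodule R} (g : W ⟶ D), g ≫ cokerπ f = 0 → ∀ w, ∃ c, f.f c = g.f w :=
      fun g hg w => (cokerπ_eq_zero f _).1
        (ConcreteCategory.congr_hom (congrArg Monad.Algebra.Hom.f hg) w)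
    KernelFork.IsLimit.ofι f (comp_cokerπ f)
      (fun {W} g hg => mkHom (fun w => (key g hg w).choose) fun r => hf (by
        rw [(key g hg _).choose_spec, hom_act, hom_act, map_map]
        congr 2
        exact funext fun w => (key g hg w).choose_spec.symm))
      (fun g hg => hom_ext fun w => (key g hg w).choose_spec)
      (fun g hg m hm => by rw [← cancel_mono f, hm]
                           exact (hom_ext fun w => (key g hg w).choose_spec).symm)⟩⟩

/-- The morphism `R[[X]] → C` extending a map `X → C`. -/
def freeLift {C : Contramodule R} {X : Type u} (g : X → C.A) : (contraMonad R).free.obj X ⟶ C :=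
  mkHom (C := (contraMonad R).free.obj X) (fun r => act C (map g r)) fun r =>
    (congrArg (act C) (map_bind g (r : convComb R (convComb R X)) id)).trans (act_bind C _ _)

theorem freeLift_point {C : Contramodule R} {X : Type u} (g : X → C.A) (x : X) :
    (freeLift g).f (point x : convComb R X) = g x :=
  (congrArg (act C) (map_point g x)).trans (act_point C _)

instance : IsNormalEpiCategory (Contramodule R) where
  normalEpiOfEpi {C D} f _ :=
    have w : freeLift (fun c : {c : C.A // f.f c = 0} => c.1) ≫ f = 0 := hom_ext fun r => by
      have key : ∀ r : convComb R {c : C.A // f.f c = 0},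
          f.f (act C (map (fun c => c.1) r)) = 0 := fun r => by
        rw [hom_act, map_map]
        exact (congrArg (fun g => act D (map g r)) (funext fun c => c.2)).trans (act_map_zero D r)
      exact key r
    ⟨⟨_, freeLift (fun c : {c : C.A // f.f c = 0} => c.1), w,
      CokernelCofork.IsColimit.ofπ f w
      (fun g hg => desc f (surjective_of_epi f) g fun c hc => by
        have := ConcreteCategory.congr_hom (congrArg Monad.Algebra.Hom.f hg)
          (point ⟨c, hc⟩ : convComb R {c : C.A // f.f c = 0})
        refine Eq.trans ?_ this
        exact congrArg g.f (freeLift_point (fun c : {c : C.A // f.f c = 0} => c.1) ⟨c, hc⟩).symm)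
      (fun g hg => comp_desc _ _ _ _)
      (fun g hg m hm => by rw [← cancel_epi f, hm, comp_desc])⟩⟩

instance : Abelian (Contramodule R) where

instance : EnoughProjectives (Contramodule R) where
  presentation C := ⟨{
    p := (contraMonad R).free.obj C.A
    f := freeLift id
    projective := by
      have : (contraMonad R).forget.PreservesEpimorphisms :=
        ⟨fun f _ => (epi_iff_surjective _).2 (surjective_of_epi f)⟩
      exact (contraMonad R).adj.map_projective _ inferInstance
    epi := epi_of_surjective _ fun c => ⟨(point c : convComb R C.A), freeLift_point _ _⟩ }⟩

/-! Discrete right modules and the contratensor product. -/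

variable (R) in
/-- A right `R`-module `N` (that is, a left module over the opposite ring) is discrete if the
annihilator of every element is open in `R`. -/
class IsDiscreteModule (N : Type u) [AddCommGroup N] [Module Rᵐᵒᵖ N] : Prop where
  isOpen_ann : ∀ b : N, IsOpen {r : R | MulOpposite.op r • b = 0}

variable (N : Type u) [AddCommGroup N] [Module Rᵐᵒᵖ N] [IsDiscreteModule R N]

theorem finite_support {X : Type*} (b : N) (r : convComb R X) :
    (Function.support fun x => MulOpposite.op (r.1 x) • b).Finite :=
  r.2 ((IsDiscreteModule.isOpen_ann b).mem_nhds (by simp))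

variable {N} in
/-- The finite formal linear combination `∑ (b r_x) x` in `N[X]`, for `b` in `N` and `∑ r_x x` in
`R[[X]]`. -/
def mulComb {X : Type*} (b : N) (r : convComb R X) : X →₀ N :=
  Finsupp.ofSupportFinite (fun x => MulOpposite.op (r.1 x) • b) (finite_support N b r)

variable {N} in
theorem mulComb_map {X Y : Type*} (f : X → Y) (b : N) (r : convComb R X) :
    mulComb b (map f r) = (mulComb b r).mapDomain f := by
  classical
  ext y
  let _ : TopologicalSpace N := ⊥
  have : DiscreteTopology N := ⟨rfl⟩
  let φ : R →+ N := AddMonoidHom.mk' (fun r => MulOpposite.op r • b) fun r s => by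
    simp [add_smul]
  have hφ : Continuous φ := continuous_of_continuousAt_zero φ <| by
    rw [ContinuousAt, map_zero, nhds_discrete N, tendsto_pure]
    exact (IsDiscreteModule.isOpen_ann b).mem_nhds (by simp)
  have h := (summable_of_tendsto r.2).subtype (f ⁻¹' {y})
  have h1 : φ ((map f r).1 y) = ∑' x : f ⁻¹' {y}, φ (r.1 x) := (h.map_tsum φ hφ)
  change φ ((map f r).1 y) = _
  rw [h1, tsum_subtype (f ⁻¹' {y}) fun x => φ (r.1 x), Finsupp.mapDomain, Finsupp.sum_apply,
    Finsupp.sum, tsum_eq_sum (s := (mulComb b r).support)]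
  · refine Finset.sum_congr rfl fun x _ => ?_
    by_cases hx : f x = y
    · subst hx; simp [φ]; rfl
    · simp [hx]
  · intro x hx
    have : φ (r.1 x) = 0 := Finsupp.notMem_support_iff.1 hx
    simp [Set.indicator, this]

open TensorProduct

/-- The subgroup of `N ⊗ C` generated by the elements `b ⊗ π(∑ r_c c) - ∑ (b r_c) ⊗ c`, which is
the image of the difference of the two maps from `N ⊗ R[[C]]` to `N ⊗ C`. -/
def contratensorRel (C : Contramodule R) : AddSubgroup (N ⊗[ℤ] C.A) :=
  AddSubgroup.closure {t | ∃ (b : N) (r : convComb R C.A),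
    t = b ⊗ₜ act C r - (mulComb b r).sum fun c n => n ⊗ₜ c}

/-- The contratensor product `N ⊙_R C`. -/
abbrev ContratensorProduct (C : Contramodule R) : Type u := (N ⊗[ℤ] C.A) ⧸ contratensorRel N C

/-- The map `N ⊙_R C → N ⊙_R D` induced by a morphism `C → D`, `b ⊗ c ↦ b ⊗ f c`. -/
def contratensorMap {C D : Contramodule R} (f : C ⟶ D) :
    ContratensorProduct N C →+ ContratensorProduct N D :=
  QuotientAddGroup.map _ _ ((homAdd f).toIntLinearMap.lTensor N).toAddMonoidHom <| by
    rw [contratensorRel, AddSubgroup.closure_le]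
    rintro _ ⟨b, r, rfl⟩
    refine AddSubgroup.subset_closure ⟨b, map f.f r, ?_⟩
    rw [mulComb_map, ← hom_act, Finsupp.sum_mapDomain_index (by simp)
      (by simp [TensorProduct.add_tmul])]
    change (homAdd f).toIntLinearMap.lTensor N _ = _
    rw [_root_.map_sub, Finsupp.sum, map_sum]
    rfl

theorem contratensorMap_mk {C D : Contramodule R} (f : C ⟶ D) (x : N ⊗[ℤ] C.A) :
    contratensorMap N f (x : ContratensorProduct N C) =
      ((homAdd f).toIntLinearMap.lTensor N x : N ⊗[ℤ] D.A) := rfl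

theorem contratensorMap_id (C : Contramodule R) :
    contratensorMap N (𝟙 C) = AddMonoidHom.id _ := by
  refine AddMonoidHom.ext fun x => ?_
  obtain ⟨x, rfl⟩ := QuotientAddGroup.mk_surjective x
  have : (homAdd (𝟙 C)).toIntLinearMap = LinearMap.id := rfl
  rw [contratensorMap_mk, this, LinearMap.lTensor_id]
  rfl

theorem contratensorMap_comp {C D E : Contramodule R} (f : C ⟶ D) (g : D ⟶ E) :
    contratensorMap N (f ≫ g) = (contratensorMap N g).comp (contratensorMap N f) := by
  refine AddMonoidHom.ext fun x => ?_
  obtain ⟨x, rfl⟩ := QuotientAddGroup.mk_surjective x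
  have : (homAdd (f ≫ g)).toIntLinearMap =
    (homAdd g).toIntLinearMap ∘ₗ (homAdd f).toIntLinearMap := rfl
  rw [contratensorMap_mk, this, LinearMap.lTensor_comp]
  rfl

theorem contratensorMap_add {C D : Contramodule R} (f g : C ⟶ D) :
    contratensorMap N (f + g) = contratensorMap N f + contratensorMap N g := by
  refine AddMonoidHom.ext fun x => ?_
  obtain ⟨x, rfl⟩ := QuotientAddGroup.mk_surjective x
  have : (homAdd (f + g)).toIntLinearMap =
    (homAdd f).toIntLinearMap + (homAdd g).toIntLinearMap := rfl
  rw [contratensorMap_mk, this, LinearMap.lTensor_add]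
  rfl

variable (R) in
/-- The functor of contratensor product `C ↦ N ⊙_R C`. -/
def contratensor : Contramodule R ⥤ AddCommGrpCat.{u} where
  obj C := AddCommGrpCat.of (ContratensorProduct N C)
  map f := AddCommGrpCat.ofHom (contratensorMap N f)
  map_id C := by rw [contratensorMap_id]; rfl
  map_comp f g := by rw [contratensorMap_comp]; rfl

instance : (contratensor R N).Additive where
  map_add {_ _ f g} := congrArg AddCommGrpCat.ofHom (contratensorMap_add N f g)

variable (R) in
/-- The left derived functors of the contratensor product, constructed by means of projective
resolutions of the contramodule argument. -/
def ctrtor (i : ℕ) : Contramodule R ⥤ AddCommGrpCat.{u} := (contratensor R N).leftDerived i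

/-- `n`-strict flatness: `Ctrtor_i(N, F) = 0` for all discrete right modules `N` and
`1 ≤ i ≤ n`. -/
def IsStrictlyFlat (n : ℕ) (F : Contramodule R) : Prop :=
  ∀ (N : Type u) [AddCommGroup N] [Module Rᵐᵒᵖ N] [IsDiscreteModule R N] (i : ℕ),
    1 ≤ i → i ≤ n → IsZero ((ctrtor R N i).obj F)

/-- `∞`-strict flatness: `n`-strict flatness for all `n > 0`. -/
def IsInftyStrictlyFlat (F : Contramodule R) : Prop := ∀ n, 0 < n → IsStrictlyFlat n F

variable (R) in
/-- The free contramodule with one generator, `R[[pt]] = R`. -/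
abbrev freeOne : Contramodule R := (contraMonad R).free.obj PUnit

/-- Right multiplication by `a`, as an endomorphism of the free contramodule `R`. -/
def mulRight (a : R) : freeOne R ⟶ freeOne R :=
  mkHom (C := freeOne R) (D := freeOne R)
    (fun r : convComb R PUnit => (⟨fun x => r.1 x * a, tendsto_mul_right r.2 _⟩ :
      convComb R PUnit)) fun r => by
    let m : convComb R PUnit.{u + 1} → convComb R PUnit.{u + 1} :=
      fun r => ⟨fun x => r.1 x * a, tendsto_mul_right r.2 _⟩
    have key : ∀ r : convComb R (convComb R PUnit), m (join r) = join (map m r) := fun r => by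
      rw [join_eq_bind (map m r), bind_map]
      ext x
      change (∑' y, r.1 y * y.1 x) * a = ∑' y, r.1 y * (y.1 x * a)
      simp_rw [← mul_assoc]
      exact (Summable.tsum_mul_right a (summable_of_tendsto
        (tendsto_mul_right r.2 fun y => y.1 x))).symm
    exact key r

/-- The sequence `R → R → R → ⋯` of right multiplications by `a 0, a 1, a 2, …`, whose direct limit
is the Bass flat contramodule associated with `a`. -/
def bassSequence (a : ℕ → R) : ℕ ⥤ Contramodule R :=
  Functor.ofSequence (X := fun _ => freeOne R) fun n => mulRight (a n)

end

end Contra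

/-! A nonempty countable directed preorder has a cofinal sequence, so only sequences `F : ℕ ⥤
Contramodule R` matter. The direct limit of a sequence is the cokernel of the telescope map `id -
shift` on `∐ F.obj`. If all terms are projective and this map is a monomorphism, it is a projective
resolution of length one of the limit. This bounds the projective dimension, and `Ctrtor_i` vanishes
for `i ≥ 1` as soon as contratensoring keeps the map injective.

Both injectivity statements have one source. Elements of `∐ C` are infinite combinations of elements
of the summands, but contratensoring with a discrete module `N` makes them finite, so an element of
`N ⊙ ∐ C` is determined by its components in the `N ⊙ C n` (`contratensor_coproduct_eq_zero`). The
triangular shape of the telescope then gives injectivity after contratensoring, for every `N`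
(`contratensorMap_telescope_injective`).

To return to contramodules, note that the modules `R ⧸ I`, with `I` an open right ideal, separate
the elements of a projective contramodule (`eq_zero_of_ctmul`). Hence a morphism out of a projective
contramodule which is injective after contratensoring with every discrete `N` is a monomorphism
(`mono_of_contratensorMap_injective`). -/

namespace CategoryTheory

/-! ### Projective resolutions of length one and their derived functors. -/

section LengthOne

variable {A : Type*} [Category* A] [Abelian A] {S : ShortComplex A}
  [Projective S.X₁] [Projective S.X₂]

/-- A two-term chain complex, concentrated in degrees `1` and `0`. -/
noncomputable abbrev twoTerm {X Y : A} (f : X ⟶ Y) : ChainComplex A ℕ :=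
  HomologicalComplex.double f (show (ComplexShape.down ℕ).Rel 1 0 by simp)

theorem isZero_twoTerm_X {X Y : A} (f : X ⟶ Y) (n : ℕ) : IsZero ((twoTerm f).X (n + 2)) :=
  HomologicalComplex.isZero_double_X _ _ _ (by simp) (by simp)

theorem mono_twoTerm_d {X Y : A} (f : X ⟶ Y) [Mono f] : Mono ((twoTerm f).d 1 0) := by
  rw [HomologicalComplex.double_d _ _ one_ne_zero]
  infer_instance

/-- The augmentation of the two-term complex of a short complex. -/
noncomputable def twoTermπ (S : ShortComplex A) :
    twoTerm S.f ⟶ (ChainComplex.single₀ A).obj S.X₃ :=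
  (ChainComplex.toSingle₀Equiv _ _).symm
    ⟨(HomologicalComplex.doubleXIso₁ _ _ one_ne_zero).hom ≫ S.g, by
      rw [HomologicalComplex.double_d _ _ one_ne_zero]
      simp⟩

theorem twoTermπ_f_zero (S : ShortComplex A) :
    (twoTermπ S).f 0 = (HomologicalComplex.doubleXIso₁ S.f _ one_ne_zero).hom ≫ S.g :=
  ChainComplex.toSingle₀Equiv_symm_apply_f_zero _ _

/-- The projective resolution of length one given by a short exact sequence
whose first two terms are projective. -/
noncomputable def ShortComplex.ShortExact.projectiveResolution (hS : S.ShortExact) :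
    ProjectiveResolution S.X₃ where
  complex := twoTerm S.f
  projective n := by
    match n with
    | 0 => exact Projective.of_iso (HomologicalComplex.doubleXIso₁ _ _ one_ne_zero).symm ‹_›
    | 1 => exact Projective.of_iso (HomologicalComplex.doubleXIso₀ _ _).symm ‹_›
    | n + 2 => exact (isZero_twoTerm_X S.f _).projective
  π := twoTermπ S
  quasiIso := ⟨fun n => by
    have := hS.mono_f
    have := hS.epi_g
    match n with
    | 0 =>
      -- In degree 0 a quasi-isomorphism onto a single object means exactness at `S.X₂` together
      -- with `S.g` being an epimorphism.
      rw [ChainComplex.quasiIsoAt₀_iff, ShortComplex.quasiIso_iff_of_zeros']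
      · refine (ShortComplex.exact_and_epi_g_iff_of_iso ?_).2 ⟨hS.exact, hS.epi_g⟩
        refine ShortComplex.isoMk
          (HomologicalComplex.doubleXIso₀ S.f (show (ComplexShape.down ℕ).Rel 1 0 by simp))
          (HomologicalComplex.doubleXIso₁ S.f
            (show (ComplexShape.down ℕ).Rel 1 0 by simp) one_ne_zero) (Iso.refl _) ?_ ?_
        · have : (HomologicalComplex.doubleXIso₀ S.f _).hom ≫ S.f = (twoTerm S.f).d 1 0 ≫
              (HomologicalComplex.doubleXIso₁ S.f _ one_ne_zero).hom := by
            rw [HomologicalComplex.double_d _ _ one_ne_zero]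
            simp
          exact this
        · exact (twoTermπ_f_zero S).symm.trans (Category.comp_id _).symm
      · exact HomologicalComplex.double_d_eq_zero₀ S.f
          (show (ComplexShape.down ℕ).Rel 1 0 by simp) 0 0 zero_ne_one
      · rfl
      · rfl
    | 1 =>
      rw [quasiIsoAt_iff_exactAt' _ _ (ChainComplex.exactAt_succ_single_obj _ _),
        HomologicalComplex.exactAt_iff' _ 2 1 0 (by simp) (by simp)]
      -- Nothing lives in degree 2, so exactness in degree 1 is monicity of the differential.
      refine (ShortComplex.exact_iff_mono _
        ((isZero_twoTerm_X S.f 0).eq_of_src _ _)).2 ?_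
      exact mono_twoTerm_d S.f
    | n + 2 =>
      rw [quasiIsoAt_iff_exactAt' _ _ (ChainComplex.exactAt_succ_single_obj _ _)]
      exact ShortComplex.exact_of_isZero_X₂ _
        (isZero_twoTerm_X S.f _)⟩

/-- The higher left derived functors vanish on the cokernel of a monomorphism of projective
objects which the functor takes to a monomorphism. -/
theorem ShortComplex.ShortExact.isZero_leftDerived_obj (hS : S.ShortExact)
    {B : Type*} [Category* B] [Abelian B]
    [HasProjectiveResolutions A] (F : A ⥤ B) [F.Additive] (hF : Mono (F.map S.f)) (i : ℕ) :
    IsZero ((F.leftDerived (i + 1)).obj S.X₃) := by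
  refine IsZero.of_iso ?_ (hS.projectiveResolution.isoLeftDerivedObj F (i + 1))
  change IsZero (((F.mapHomologicalComplex _).obj (twoTerm S.f)).homology (i + 1))
  rw [← HomologicalComplex.exactAt_iff_isZero_homology]
  match i with
  | 0 =>
    -- Degree 1 is the only case with content: the homology there is the kernel of `F.map S.f`.
    rw [HomologicalComplex.exactAt_iff' _ 2 1 0 (by simp) (by simp)]
    refine (ShortComplex.exact_iff_mono _ ((F.map_isZero
      (isZero_twoTerm_X S.f 0)).eq_of_src _ _)).2 ?_
    change Mono (F.map ((twoTerm S.f).d 1 0))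
    rw [HomologicalComplex.double_d _ _ one_ne_zero, F.map_comp, F.map_comp]
    infer_instance
  | i + 1 =>
    exact ShortComplex.exact_of_isZero_X₂ _ (F.map_isZero
      (isZero_twoTerm_X S.f _))

end LengthOne

end CategoryTheory

namespace Contra

noncomputable section

variable {R : Type u} [Ring R] [UniformSpace R] [IsUniformAddGroup R] [IsTopologicalRing R]
  [IsLinearTopology Rᵐᵒᵖ R] [CompleteSpace R] [T2Space R]

/-! ### Morphisms out of free contramodules. -/

/-- An element of `R[[X]]` is the contraaction applied to the combination of its own points with the
same coefficients, and morphisms commute with contraactions. -/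
theorem free_hom_apply {C : Contramodule R} {X : Type u} (f : (contraMonad R).free.obj X ⟶ C)
    (r : convComb R X) : f.f r = act C (map (fun x => f.f (point x : convComb R X)) r) := by
  have h : join (map point r) = r := by
    rw [join_eq_bind, bind_map]
    exact bind_point r
  have h1 := hom_act f (map point r)
  exact (congrArg f.f h.symm).trans (h1.trans (congrArg (act C) (map_map _ _ r)))

theorem free_hom_ext {C : Contramodule R} {X : Type u} {f g : (contraMonad R).free.obj X ⟶ C}
    (h : ∀ x, f.f (point x : convComb R X) = g.f (point x : convComb R X)) : f = g :=
  hom_ext fun r => by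
    refine (free_hom_apply f r).trans (Eq.trans ?_ (free_hom_apply g r).symm)
    exact congrArg (fun k => act C (map k r)) (funext h)

instance free_projective (X : Type u) : Projective ((contraMonad R).free.obj X) := by
  have : (contraMonad R).forget.PreservesEpimorphisms :=
    ⟨fun f _ => (epi_iff_surjective _).2 (surjective_of_epi f)⟩
  exact (contraMonad R).adj.map_projective _ inferInstance

/-! Coproducts. -/

section Coproduct

-- With the index type in `Type`, the generating set `Σ i, (C i).A` stays in `Type u`.
variable {ι : Type} (C : ι → Contramodule R)

/-- The free contramodule on the disjoint union of the contramodules `C i`. -/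
abbrev coprodGen : Contramodule R := (contraMonad R).free.obj (Σ i, (C i).A)

/-- The relations defining the coproduct: `∑ r_c (i, c)`. -/
def coprodRelLeft : (contraMonad R).free.obj (Σ i, convComb R (C i).A) ⟶ coprodGen C :=
  freeLift (C := coprodGen C) fun p => map (fun c => Sigma.mk p.1 c) p.2

/-- The relations defining the coproduct: `(i, π(∑ r_c c))`. -/
def coprodRelRight : (contraMonad R).free.obj (Σ i, convComb R (C i).A) ⟶ coprodGen C :=
  freeLift (C := coprodGen C) fun p =>
    (point (Sigma.mk p.1 (act (C p.1) p.2)) : convComb R (Σ i, (C i).A))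

/-- This is what makes the insertions `c ↦ (i, c)` into the coproduct contramodule morphisms. -/
theorem coprodRel_condition {D : Contramodule R} (q : coprodGen C ⟶ D)
    (h : coprodRelLeft C ≫ q = coprodRelRight C ≫ q) (i : ι) (r : convComb R (C i).A) :
    q.f (point (⟨i, act (C i) r⟩ : Σ i, (C i).A) : convComb R _) =
      act D (map (fun c => q.f (point (⟨i, c⟩ : Σ i, (C i).A) : convComb R _)) r) := by
  have h := ConcreteCategory.congr_hom (congrArg Monad.Algebra.Hom.f h)
    (point ⟨i, r⟩ : convComb R (Σ i, convComb R (C i).A))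
  have h1 := congrArg q.f (freeLift_point (C := coprodGen C)
    (fun p : Σ i, convComb R (C i).A => map (fun c => Sigma.mk p.1 c) p.2) ⟨i, r⟩)
  have h2 := congrArg q.f (freeLift_point (C := coprodGen C)
    (fun p : Σ i, convComb R (C i).A =>
      (point (Sigma.mk p.1 (act (C p.1) p.2)) : convComb R (Σ i, (C i).A))) ⟨i, r⟩)
  have h3 := free_hom_apply q (map (fun c => (⟨i, c⟩ : Σ i, (C i).A)) r)
  rw [map_map] at h3
  exact (h2.symm.trans (h.symm.trans h1)).trans h3

/-- The coproduct of contramodules, by generators and relations. -/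
def coprodCofan : Cofan C :=
  Cofan.mk (coequalizer (coprodRelLeft C) (coprodRelRight C)) fun i =>
    mkHom (fun c => (coequalizer.π (coprodRelLeft C) (coprodRelRight C)).f
      (point (⟨i, c⟩ : Σ i, (C i).A) : convComb R _)) fun r =>
        coprodRel_condition C _ (coequalizer.condition _ _) i r

/-- The relations only encode compatibility with the contraaction in each `C i`, which every `g i`
has by `hom_act`. -/
theorem coprodRel_freeLift {D : Contramodule R} (g : ∀ i, C i ⟶ D) :
    coprodRelLeft C ≫ freeLift (fun p : Σ i, (C i).A => (g p.1).f p.2) =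
      coprodRelRight C ≫ freeLift (fun p : Σ i, (C i).A => (g p.1).f p.2) :=
  free_hom_ext fun ⟨i, r⟩ => by
    have h1 := congrArg (freeLift fun p : Σ i, (C i).A => (g p.1).f p.2).f
      (freeLift_point (C := coprodGen C)
        (fun p : Σ i, convComb R (C i).A => map (fun c => Sigma.mk p.1 c) p.2) ⟨i, r⟩)
    have h2 := congrArg (freeLift fun p : Σ i, (C i).A => (g p.1).f p.2).f
      (freeLift_point (C := coprodGen C) (fun p : Σ i, convComb R (C i).A =>
        (point (Sigma.mk p.1 (act (C p.1) p.2)) : convComb R (Σ i, (C i).A))) ⟨i, r⟩)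
    refine h1.trans (Eq.trans ?_ h2.symm)
    refine Eq.trans ?_ (freeLift_point _ _).symm
    refine Eq.trans ?_ (hom_act (g i) r).symm
    exact congrArg (act D) (map_map _ _ r)

theorem hasCoproduct : HasCoproduct C :=
  ⟨⟨coprodCofan C, Cofan.IsColimit.mk _
    (fun s => coequalizer.desc (freeLift fun p : Σ i, (C i).A => (s.inj p.1).f p.2)
      (coprodRel_freeLift C s.inj))
    (fun s i => hom_ext fun c => by
      have h := ConcreteCategory.congr_hom (congrArg Monad.Algebra.Hom.f
        (coequalizer.π_desc (freeLift fun p : Σ i, (C i).A => (s.inj p.1).f p.2)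
          (coprodRel_freeLift C s.inj))) (point (⟨i, c⟩ : Σ i, (C i).A) : convComb R _)
      exact h.trans (freeLift_point _ _))
    (fun s m hm => coequalizer.hom_ext <| by
      rw [coequalizer.π_desc]
      refine free_hom_ext fun ⟨i, c⟩ => Eq.trans ?_ (freeLift_point _ _).symm
      exact ConcreteCategory.congr_hom (congrArg Monad.Algebra.Hom.f (hm i)) c)⟩⟩

end Coproduct

instance : HasColimitsOfShape (Discrete ℕ) (Contramodule R) where
  has_colimit F := by
    have : HasColimit (Discrete.functor (F.obj ∘ Discrete.mk)) := hasCoproduct _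
    exact hasColimit_of_iso (Discrete.natIsoFunctor (F := F))

/-- Every element of a coproduct is an infinite linear combination of elements of the summands. -/
theorem exists_eq_act_coproduct (C : ℕ → Contramodule R) (p : (∐ C).A) :
    ∃ r : convComb R (Σ n, (C n).A),
      p = act (∐ C) (map (fun x => (Sigma.ι C x.1).f x.2) r) := by
  let q : coprodGen C ⟶ ∐ C := freeLift fun x => (Sigma.ι C x.1).f x.2
  -- Epimorphisms are surjective, and the universal property of the coproduct makes being epi a
  -- check on generators.
  have : Epi q := ⟨fun g h hgh => Sigma.hom_ext _ _ fun n => hom_ext fun c => by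
    have h1 := ConcreteCategory.congr_hom (congrArg Monad.Algebra.Hom.f hgh)
      (point ⟨n, c⟩ : convComb R (Σ n, (C n).A))
    have h2 := freeLift_point (fun x : Σ n, (C n).A => (Sigma.ι C x.1).f x.2) ⟨n, c⟩
    exact (congrArg g.f h2).symm.trans (h1.trans (congrArg h.f h2))⟩
  obtain ⟨r, hr⟩ := surjective_of_epi q p
  exact ⟨r, hr.symm⟩

/-! Contratensor products and coproducts. -/

open TensorProduct

section Contratensor

variable (N : Type u) [AddCommGroup N] [Module Rᵐᵒᵖ N] [IsDiscreteModule R N]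

variable {N} in
/-- The class of `b ⊗ c` in the contratensor product. -/
def ctmul {C : Contramodule R} (b : N) (c : C.A) : ContratensorProduct N C :=
  ((b ⊗ₜ c : N ⊗[ℤ] C.A) : ContratensorProduct N C)

theorem contratensorMap_ctmul {C D : Contramodule R} (f : C ⟶ D) (b : N) (c : C.A) :
    contratensorMap N f (ctmul b c) = ctmul b (f.f c) := rfl

theorem ctmul_act {C : Contramodule R} (b : N) (r : convComb R C.A) :
    (ctmul b (act C r) : ContratensorProduct N C) = (mulComb b r).sum fun c n => ctmul n c := by
  have h : QuotientAddGroup.mk' (contratensorRel N C)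
      (b ⊗ₜ act C r - (mulComb b r).sum fun c n => n ⊗ₜ c) = 0 :=
    (QuotientAddGroup.eq_zero_iff _).2 (AddSubgroup.subset_closure ⟨b, r, rfl⟩)
  rw [_root_.map_sub, sub_eq_zero] at h
  refine h.trans ?_
  exact map_sum (QuotientAddGroup.mk' (contratensorRel N C)) _ _

theorem contratensor_induction {C : Contramodule R} {H : AddSubgroup (ContratensorProduct N C)}
    (h : ∀ (b : N) (c : C.A), ctmul b c ∈ H) (z : ContratensorProduct N C) : z ∈ H := by
  obtain ⟨x, rfl⟩ := QuotientAddGroup.mk_surjective z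
  induction x with
  | zero => exact H.zero_mem
  | tmul b c => exact h b c
  | add x y hx hy => exact H.add_mem hx hy

/-- The contratensor product with a coproduct is generated by the images of the contratensor
products with the summands. -/
theorem exists_eq_sum_contratensor (C : ℕ → Contramodule R) (z : ContratensorProduct N (∐ C)) :
    ∃ w : Π₀ n, ContratensorProduct N (C n),
      z = w.sumAddHom fun n => contratensorMap N (Sigma.ι C n) := by
  classical
  let Φ : (Π₀ n, ContratensorProduct N (C n)) →+ ContratensorProduct N (∐ C) :=
    DFinsupp.sumAddHom fun n => contratensorMap N (Sigma.ι C n)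
  suffices h : z ∈ Φ.range by
    obtain ⟨w, hw⟩ := h
    exact ⟨w, hw.symm⟩
  refine contratensor_induction N (fun b c => ?_) z
  obtain ⟨r, rfl⟩ := exists_eq_act_coproduct C c
  -- Discreteness of `N` enters here: all but finitely many coefficients kill `b`, so the infinite
  -- combination becomes a finite sum of tensors, each coming from one summand.
  rw [ctmul_act, Finsupp.sum]
  refine sum_mem fun c hc => ?_
  rw [mulComb_map] at hc
  obtain ⟨x, -, rfl⟩ := Finset.mem_image.1 (Finsupp.mapDomain_support hc)
  refine ⟨DFinsupp.single x.1 (ctmul (mulComb b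
    (map (fun x => (Sigma.ι C x.1).f x.2) r) ((Sigma.ι C x.1).f x.2)) x.2), ?_⟩
  refine (DFinsupp.sumAddHom_single _ _ _).trans ?_
  exact contratensorMap_ctmul N _ _ _

/-- The projection of a coproduct onto a summand. -/
def proj (C : ℕ → Contramodule R) (n : ℕ) : ∐ C ⟶ C n :=
  Sigma.desc fun m => if h : m = n then eqToHom (by rw [h]) else 0

theorem ι_proj_self (C : ℕ → Contramodule R) (n : ℕ) : Sigma.ι C n ≫ proj C n = 𝟙 _ := by
  simp [proj]

theorem ι_proj_ne (C : ℕ → Contramodule R) {m n : ℕ} (h : m ≠ n) :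
    Sigma.ι C m ≫ proj C n = 0 := by
  simp [proj, h]

theorem contratensorMap_zero (C D : Contramodule R) : contratensorMap N (0 : C ⟶ D) = 0 := by
  have := contratensorMap_add N (0 : C ⟶ D) 0
  simpa using this

/-- Since `z` is a finite sum of images of elements `w n` of the `N ⊙ C n`, the projection to `C n`
recovers `w n`. -/
theorem contratensor_coproduct_eq_zero (C : ℕ → Contramodule R)
    (z : ContratensorProduct N (∐ C)) (hz : ∀ n, contratensorMap N (proj C n) z = 0) : z = 0 := by
  classical
  obtain ⟨w, rfl⟩ := exists_eq_sum_contratensor N C z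
  suffices h : w = 0 by rw [h, map_zero]
  ext1 n
  refine Eq.trans ?_ (hz n)
  rw [DFinsupp.sumAddHom_apply, DFinsupp.sum, map_sum]
  have key : ∀ m, contratensorMap N (proj C n) (contratensorMap N (Sigma.ι C m) (w m)) =
      if m = n then contratensorMap N (proj C n) (contratensorMap N (Sigma.ι C m) (w m))
        else 0 := fun m => by
    split_ifs with h
    · rfl
    · rw [← AddMonoidHom.comp_apply, ← contratensorMap_comp, ι_proj_ne _ h, contratensorMap_zero,
        AddMonoidHom.zero_apply]
  rw [Finset.sum_congr rfl fun m _ => key m, Finset.sum_ite_eq']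
  split_ifs with h
  · rw [← AddMonoidHom.comp_apply, ← contratensorMap_comp, ι_proj_self, contratensorMap_id]
    rfl
  · exact DFinsupp.notMem_support_iff.1 h

end Contratensor

/-! Projective contramodules are separated by contratensor products. -/

section Separated

theorem op_add_smul {N : Type u} [AddCommGroup N] [Module Rᵐᵒᵖ N] (b : N) (r s : R) :
    MulOpposite.op (r + s) • b = MulOpposite.op r • b + MulOpposite.op s • b := by
  rw [MulOpposite.op_add, add_smul]

/-- The additive map `R → N`, `r ↦ b r`. -/
def orbitHom {N : Type u} [AddCommGroup N] [Module Rᵐᵒᵖ N] (b : N) : R →+ N :=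
  AddMonoidHom.mk' (fun r => MulOpposite.op r • b) (op_add_smul b)

/-- The kernel of `r ↦ b r` is open, so this map is continuous for the discrete topology on `N` and
commutes with convergent sums, which become finite in `N`. -/
theorem orbitHom_tsum {N : Type u} [AddCommGroup N] [Module Rᵐᵒᵖ N] [IsDiscreteModule R N]
    (b : N) {X : Type u} (r : convComb R X) (t : X → R) :
    orbitHom b (∑' x, r.1 x * t x) =
      (mulComb b r).sum fun x n => MulOpposite.op (t x) • n := by
  let _ : TopologicalSpace N := ⊥
  have : DiscreteTopology N := ⟨rfl⟩
  have hφ : Continuous (orbitHom (R := R) b) := continuous_of_continuousAt_zero _ <| by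
    rw [ContinuousAt, map_zero, nhds_discrete N, tendsto_pure]
    exact (IsDiscreteModule.isOpen_ann b).mem_nhds (by simp)
  rw [(summable_of_tendsto (tendsto_mul_right r.2 t)).map_tsum _ hφ, Finsupp.sum,
    tsum_eq_sum (s := (mulComb b r).support)]
  · exact Finset.sum_congr rfl fun x _ => by
      change MulOpposite.op (r.1 x * t x) • b = MulOpposite.op (t x) • MulOpposite.op (r.1 x) • b
      rw [MulOpposite.op_mul, mul_smul]
  · intro x hx
    have hx : MulOpposite.op (r.1 x) • b = 0 := Finsupp.notMem_support_iff.1 hx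
    change MulOpposite.op (r.1 x * t x) • b = 0
    rw [MulOpposite.op_mul, mul_smul, hx, smul_zero]

variable (N : Type u) [AddCommGroup N] [Module Rᵐᵒᵖ N] [IsDiscreteModule R N]

theorem bindHom_id_point_add_point {X : Type u} (r s : convComb R X) :
    bindHom id (point r + point s) = r + s := by
  rw [map_add, bindHom_point, bindHom_point]
  rfl

/-- Addition on a contramodule is defined through its contraaction; on a free contramodule it has to
be identified with the coefficientwise one. -/
theorem free_add {X : Type u} (r s : convComb R X) :
    @HAdd.hAdd ((contraMonad R).free.obj X).A ((contraMonad R).free.obj X).A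
      ((contraMonad R).free.obj X).A _ r s = r + s :=
  bindHom_id_point_add_point _ _

theorem free_zero {X : Type u} :
    (0 : ((contraMonad R).free.obj X).A) = (0 : convComb R X) :=
  (bindHom (id : convComb R X → convComb R X)).map_zero

/-- The coordinate map `N ⊗ R[[X]] → N`, `b ⊗ ∑ r_x x ↦ b r_x`. -/
def coordTensor {X : Type u} (x : X) :
    N ⊗[ℤ] ((contraMonad R).free.obj X).A →ₗ[ℤ] N :=
  TensorProduct.lift <| AddMonoidHom.toIntLinearMap <|
    AddMonoidHom.mk' (fun b => AddMonoidHom.toIntLinearMap <|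
      AddMonoidHom.mk' (fun r : ((contraMonad R).free.obj X).A =>
        MulOpposite.op ((r : convComb R X).1 x) • b) fun r s => by
          refine (congrArg (fun t : convComb R X => MulOpposite.op (t.1 x) • b)
            (free_add r s)).trans ?_
          exact op_add_smul b ((r : convComb R X).1 x) ((s : convComb R X).1 x))
      fun b b' => LinearMap.ext fun r => smul_add _ _ _

/-- The coordinate map `N ⊙ R[[X]] → N`, `b ⊙ ∑ r_x x ↦ b r_x`. -/
def coord {X : Type u} (x : X) :
    ContratensorProduct N ((contraMonad R).free.obj X) →+ N :=
  QuotientAddGroup.lift _ (coordTensor N x).toAddMonoidHom <| by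
    rw [contratensorRel, AddSubgroup.closure_le]
    rintro _ ⟨b, r, rfl⟩
    change coordTensor N x _ = 0
    rw [_root_.map_sub, sub_eq_zero, Finsupp.sum, map_sum]
    -- The contraaction of `R[[X]]` is `join`, whose coefficient at `x` is a convergent sum of
    -- products.
    exact orbitHom_tsum b (r : convComb R (convComb R X)) fun y => y.1 x

theorem coord_ctmul {X : Type u} (x : X) (b : N) (r : convComb R X) :
    coord N x (ctmul b (r : ((contraMonad R).free.obj X).A)) = MulOpposite.op (r.1 x) • b := rfl

end Separated

/-- The quotient of `R` by an open right ideal is a discrete right module. -/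
theorem isDiscreteModule_quotient (I : Submodule Rᵐᵒᵖ R) (hI : IsOpen (I : Set R)) :
    IsDiscreteModule R (R ⧸ I) where
  isOpen_ann b := by
    obtain ⟨s, rfl⟩ := Submodule.Quotient.mk_surjective I b
    have h : {r : R | MulOpposite.op r • (Submodule.Quotient.mk s : R ⧸ I) = 0} =
        (fun r => s * r) ⁻¹' (I : Set R) := by
      ext r
      rw [Set.mem_ofPred_eq, ← Submodule.Quotient.mk_smul, Submodule.Quotient.mk_eq_zero]
      rfl
    rw [h]
    exact hI.preimage (continuous_const_mul s)

/-- If `r_x ≠ 0`, separatedness gives an open right ideal `I` not containing `r_x`. For the class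
`b` of `1` in `R ⧸ I`, the coordinate at `x` of `b ⊙ r` is the class of `r_x`, which is nonzero. -/
theorem free_eq_zero_of_ctmul {X : Type u} (r : convComb R X)
    (h : ∀ (N : Type u) [AddCommGroup N] [Module Rᵐᵒᵖ N] [IsDiscreteModule R N] (b : N),
      (ctmul (C := (contraMonad R).free.obj X) b r : ContratensorProduct N _) = 0) : r = 0 := by
  ext x
  by_contra hx
  obtain ⟨I, hI, hIU⟩ := (IsLinearTopology.hasBasis_open_submodule (M := R) Rᵐᵒᵖ).mem_iff.1
    (isOpen_ne.mem_nhds (Ne.symm hx) : {y : R | y ≠ r.1 x} ∈ 𝓝 0)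
  have := isDiscreteModule_quotient I hI
  have h1 := congrArg (coord (R ⧸ I) x) (h (R ⧸ I) (Submodule.Quotient.mk 1))
  rw [map_zero, coord_ctmul, ← Submodule.Quotient.mk_smul, Submodule.Quotient.mk_eq_zero] at h1
  refine hIU h1 ?_
  simp

/-- An element of a projective contramodule vanishes if its products with all elements of discrete
right modules do. -/
theorem eq_zero_of_ctmul (P : Contramodule R) [Projective P] (p : P.A)
    (h : ∀ (N : Type u) [AddCommGroup N] [Module Rᵐᵒᵖ N] [IsDiscreteModule R N] (b : N),
      (ctmul b p : ContratensorProduct N P) = 0) : p = 0 := by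
  let q : (contraMonad R).free.obj P.A ⟶ P := freeLift id
  have : Epi q := epi_of_surjective _ fun c => ⟨(point c : convComb R P.A), freeLift_point _ _⟩
  -- A projective contramodule is a retract of a free one, and the section `s` transports the
  -- vanishing of all `b ⊙ p` to the free case.
  let s : P ⟶ (contraMonad R).free.obj P.A := Projective.factorThru (𝟙 P) q
  have hs : s ≫ q = 𝟙 P := Projective.factorThru_comp _ _
  have h0 : s.f p = 0 := (free_eq_zero_of_ctmul (s.f p) fun N _ _ _ b => by
    have := congrArg (contratensorMap N s) (h N b)
    rw [map_zero, contratensorMap_ctmul] at this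
    exact this).trans free_zero.symm
  have h1 : q.f (s.f p) = p := ConcreteCategory.congr_hom (congrArg Monad.Algebra.Hom.f hs) p
  rw [← h1, h0]
  exact (homAdd q).map_zero

/-- If `f p = 0`, then `b ⊙ p` maps to `b ⊙ f p = 0` for all `b`, so injectivity gives `b ⊙ p = 0`,
and the separation property of `P` gives `p = 0`. -/
theorem mono_of_contratensorMap_injective {P D : Contramodule R} [Projective P] (f : P ⟶ D)
    (hf : ∀ (N : Type u) [AddCommGroup N] [Module Rᵐᵒᵖ N] [IsDiscreteModule R N],
      Function.Injective (contratensorMap N f)) : Mono f where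
  right_cancellation {Z} g h w := hom_ext fun z => by
    have h1 : f.f (g.f z) = f.f (h.f z) :=
      ConcreteCategory.congr_hom (congrArg Monad.Algebra.Hom.f w) z
    have h2 : f.f (g.f z - h.f z) = 0 :=
      ((homAdd f).map_sub (g.f z) (h.f z)).trans (sub_eq_zero.2 h1)
    refine sub_eq_zero.1 (eq_zero_of_ctmul P _ fun N _ _ _ b => hf N ?_)
    rw [contratensorMap_ctmul, h2, map_zero]
    exact congrArg QuotientAddGroup.mk (tmul_zero _ b)

instance projective_coproduct (C : ℕ → Contramodule R) [∀ n, Projective (C n)] :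
    Projective (∐ C) where
  factors f e _ := ⟨Sigma.desc fun n => Projective.factorThru (Sigma.ι C n ≫ f) e,
    Sigma.hom_ext _ _ fun n => by
      rw [← Category.assoc, Sigma.ι_desc, Projective.factorThru_comp]⟩

/-! The telescope of a sequence of contramodules. -/

section Telescope

variable (F : ℕ ⥤ Contramodule R)

/-- The morphism `id - shift` on the coproduct of the terms of a sequence. -/
def telescope : ∐ F.obj ⟶ ∐ F.obj :=
  Sigma.desc fun n => Sigma.ι F.obj n - F.map (homOfLE n.le_succ) ≫ Sigma.ι F.obj (n + 1)

theorem ι_telescope (n : ℕ) : Sigma.ι F.obj n ≫ telescope F =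
    Sigma.ι F.obj n - F.map (homOfLE n.le_succ) ≫ Sigma.ι F.obj (n + 1) := by
  simp [telescope]

theorem telescope_proj_zero : telescope F ≫ proj F.obj 0 = proj F.obj 0 :=
  Sigma.hom_ext _ _ fun n => by
    rw [← Category.assoc, ι_telescope, Preadditive.sub_comp, Category.assoc,
      ι_proj_ne _ n.succ_ne_zero, comp_zero, sub_zero]

/-- In components the telescope is triangular: `z` goes to `z_{n+1} - F(z_n)` in position `n + 1`,
and to `z_0` in position 0. -/
theorem telescope_proj_succ (n : ℕ) : telescope F ≫ proj F.obj (n + 1) =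
    proj F.obj (n + 1) - proj F.obj n ≫ F.map (homOfLE n.le_succ) :=
  Sigma.hom_ext _ _ fun m => by
    rw [← Category.assoc, ι_telescope, Preadditive.sub_comp, Category.assoc, Preadditive.comp_sub,
      ← Category.assoc (Sigma.ι F.obj m)]
    congr 1
    by_cases h : m = n
    · subst h
      rw [ι_proj_self, ι_proj_self, Category.comp_id, Category.id_comp]
    · rw [ι_proj_ne _ h, ι_proj_ne _ (by simpa using h), comp_zero, zero_comp]

/-- If the image of `z` is zero, its components satisfy `z_0 = 0` and `z_{n+1} = F(z_n)`, so all
vanish by induction; components detect zero after contratensoring. -/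
theorem contratensorMap_telescope_injective (N : Type u) [AddCommGroup N] [Module Rᵐᵒᵖ N]
    [IsDiscreteModule R N] : Function.Injective (contratensorMap N (telescope F)) := by
  rw [injective_iff_map_eq_zero]
  intro z hz
  have key : ∀ n, contratensorMap N (telescope F ≫ proj F.obj n) z = 0 := fun n => by
    rw [contratensorMap_comp, AddMonoidHom.comp_apply, hz, map_zero]
  refine contratensor_coproduct_eq_zero N F.obj z fun n => ?_
  induction n with
  | zero =>
    have := key 0
    rwa [telescope_proj_zero] at this
  | succ n ih =>
    have h : proj F.obj (n + 1) = telescope F ≫ proj F.obj (n + 1) +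
        proj F.obj n ≫ F.map (homOfLE n.le_succ) := by
      rw [telescope_proj_succ, sub_add_cancel]
    rw [h, contratensorMap_add, AddMonoidHom.add_apply, key, contratensorMap_comp,
      AddMonoidHom.comp_apply, ih, map_zero, add_zero]

/-- With `telescope_desc`, this identifies morphisms killing the telescope with cocones over `F`, so
the cokernel has the universal property of the direct limit. -/
theorem ι_telescope_comp {D : Contramodule R} (g : ∐ F.obj ⟶ D) (hg : telescope F ≫ g = 0)
    (n : ℕ) : F.map (homOfLE n.le_succ) ≫ Sigma.ι F.obj (n + 1) ≫ g = Sigma.ι F.obj n ≫ g := by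
  have h := congrArg (Sigma.ι F.obj n ≫ ·) hg
  simp only [comp_zero, ← Category.assoc, ι_telescope, Preadditive.sub_comp] at h
  rw [← Category.assoc]
  exact (sub_eq_zero.1 h).symm

theorem telescope_desc (s : Cocone F) : telescope F ≫ Sigma.desc s.ι.app = 0 :=
  Sigma.hom_ext _ _ fun n => by
    rw [← Category.assoc, ι_telescope, Preadditive.sub_comp, Category.assoc, Sigma.ι_desc,
      Sigma.ι_desc, s.w, sub_self, comp_zero]

/-- The cokernel of the telescope morphism, as a cocone. -/
def telescopeCocone : Cocone F where
  pt := cokernel (telescope F)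
  ι := NatTrans.ofSequence (fun n => Sigma.ι F.obj n ≫ cokernel.π (telescope F)) fun n => by
    rw [ι_telescope_comp F _ (cokernel.condition _)]
    simp

/-- The cokernel of the telescope morphism is the direct limit. -/
def telescopeIsColimit : IsColimit (telescopeCocone F) where
  desc s := cokernel.desc (telescope F) (Sigma.desc s.ι.app) (telescope_desc F s)
  fac s n := by
    refine (Category.assoc (Sigma.ι F.obj n) (cokernel.π (telescope F)) _).trans ?_
    rw [cokernel.π_desc, Sigma.ι_desc]
  uniq s m hm := coequalizer.hom_ext <| Sigma.hom_ext _ _ fun n => by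
    refine Eq.trans ?_ (congrArg (Sigma.ι F.obj n ≫ ·)
      (cokernel.π_desc (telescope F) (Sigma.desc s.ι.app) (telescope_desc F s))).symm
    refine Eq.trans ?_ (Sigma.ι_desc s.ι.app n).symm
    exact (Category.assoc (Sigma.ι F.obj n) (cokernel.π (telescope F)) m).symm.trans (hm n)

theorem hasColimit_sequence : HasColimit F := ⟨⟨_, telescopeIsColimit F⟩⟩

/-! ### Sequences of projective contramodules. -/

variable [∀ n, Projective (F.obj n)]

instance mono_telescope : Mono (telescope F) :=
  mono_of_contratensorMap_injective _ fun N _ _ _ => contratensorMap_telescope_injective F N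

theorem telescope_shortExact :
    (ShortComplex.mk (telescope F) (cokernel.π _) (cokernel.condition _)).ShortExact where
  exact := ShortComplex.exact_cokernel _
  mono_f := mono_telescope F
  epi_g := inferInstanceAs (Epi (cokernel.π (telescope F)))

theorem hasProjectiveDimensionLE_cokernel_telescope :
    HasProjectiveDimensionLE (cokernel (telescope F)) 1 :=
  -- `HasProjectiveDimensionLE _ 1` means dimension `< 2`; it follows from dimension `< 1` for the
  -- first term and `< 2` for the middle one.
  (telescope_shortExact F).hasProjectiveDimensionLT_X₃ 1
    (inferInstanceAs (HasProjectiveDimensionLT (∐ F.obj) 1))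
    (inferInstanceAs (HasProjectiveDimensionLT (∐ F.obj) (1 + 1)))

theorem isInftyStrictlyFlat_cokernel_telescope :
    IsInftyStrictlyFlat (cokernel (telescope F)) := by
  intro _ _ N _ _ _ i hi _
  obtain ⟨i, rfl⟩ := Nat.exists_eq_add_of_le' hi
  have : Projective (ShortComplex.mk (telescope F) (cokernel.π _) (cokernel.condition _)).X₁ :=
    inferInstanceAs (Projective (∐ F.obj))
  have : Projective (ShortComplex.mk (telescope F) (cokernel.π _) (cokernel.condition _)).X₂ :=
    inferInstanceAs (Projective (∐ F.obj))
  refine (telescope_shortExact F).isZero_leftDerived_obj (contratensor R N) ?_ i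
  -- The injectivity that made the telescope a monomorphism also kills `Ctrtor_1`.
  rw [AddCommGrpCat.mono_iff_injective]
  exact contratensorMap_telescope_injective F N

theorem sequence_colimit {c : Cocone F} (hc : IsColimit c) :
    HasProjectiveDimensionLE c.pt 1 ∧ IsInftyStrictlyFlat c.pt := by
  let e : cokernel (telescope F) ≅ c.pt := (telescopeIsColimit F).coconePointUniqueUpToIso hc
  have := hasProjectiveDimensionLE_cokernel_telescope F
  exact ⟨hasProjectiveDimensionLT_of_iso e 2, fun n hn N _ _ _ i h1 h2 =>
    (isInftyStrictlyFlat_cokernel_telescope F n hn N i h1 h2).of_iso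
      ((ctrtor R N i).mapIso e.symm)⟩

end Telescope

end

end Contra

/-! ### From countable directed systems to sequences. -/

theorem corollary2p4 (R : Type u) [Ring R] [UniformSpace R] [IsUniformAddGroup R]
    [IsTopologicalRing R] [CompleteSpace R] [T2Space R]
    -- open right ideals form a base of neighborhoods of zero
    [IsLinearTopology Rᵐᵒᵖ R] :
    (∀ (J : Type w) [Preorder J] [IsDirectedOrder J] [Nonempty J] [Countable J]
      (F : J ⥤ Contra.Contramodule R), (∀ j, Projective (F.obj j)) →
      HasColimit F ∧
      ∀ (c : Cocone F), IsColimit c →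
        HasProjectiveDimensionLE c.pt 1 ∧ Contra.IsInftyStrictlyFlat c.pt) ∧
    (∀ a : ℕ → R,
      HasColimit (Contra.bassSequence a) ∧
      ∀ (c : Cocone (Contra.bassSequence a)), IsColimit c →
        HasProjectiveDimensionLE c.pt 1 ∧ Contra.IsInftyStrictlyFlat c.pt) := by
  refine ⟨fun J _ _ _ _ F hF => ?_, fun a => ?_⟩
  -- `T : ℕ ⥤ J` is a final functor, so restriction along it changes neither the existence of the
  -- colimit nor the colimit cocones.
  · let T := IsFiltered.sequentialFunctor J
    have : ∀ n, Projective ((T ⋙ F).obj n) := fun n => hF (T.obj n)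
    have := Contra.hasColimit_sequence (T ⋙ F)
    exact ⟨Functor.Final.hasColimit_of_comp T, fun c hc =>
      Contra.sequence_colimit (T ⋙ F) ((Functor.Final.isColimitWhiskerEquiv T c).symm hc)⟩
  · have : ∀ n, Projective ((Contra.bassSequence a).obj n) := fun _ => Contra.free_projective _
    exact ⟨Contra.hasColimit_sequence _, fun c hc => Contra.sequence_colimit _ hc⟩
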